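/- Let $a<b$, $k\in\mathbb{N}_0$, $v\in\mathbb{R}$, and let $\Omega=[a,b]$. For an integer $N>0$ put $h=(b-a)/N$ and consider the grid $x_m=a+mh$. Functions on $\Omega$ with periodic boundary conditions are identified with $(b-a)$-periodic functions on $\mathbb{R}$ (and $m$ ranges over $\mathbb{Z}$). For a periodic $\phi\in C^k$, let $P_k^+\phi$ be the piecewise Hermite interpolant: on each cell $[x_m,x_{m+1}]$, $P_k^+\phi$ is the unique polynomial of degree at most $2k+1$ whose derivatives of orders $0,\dots,k$ at $x_m$ and $x_{m+1}$ agree with those of $\phi$. Consider the advection equation $\phi_t+v\,\phi_x=0$ on $\Omega$ with periodic boundary conditions and initial condition $\phi(x,0)=\Phi(x)$, where $\Phi\in C^k$ is periodic, $\Phi^{(k)}$ is absolutely continuous, and $\Phi^{(k+1)}\in L^2(\Omega)$. Approximate its solution by the advect-and-project jet scheme $$\phi_0=\Phi,\qquad \phi_{n+1}=P_k^+\,A_{t_{n+1},t_n}\,\phi_n,\qquad t_n=n\,\Delta t,$$ where $(A_{\tau,t}\,g)(x)=g(\mathcal{X}(x,\tau,t))$ and $\mathcal{X}(x,\tau,t)$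 is the result of one step, from time $\tau$ to time $t$ and starting at $x$, of a consistent Runge--Kutta scheme (explicit or implicit) applied to the characteristic equation $dx/dt=v$. Then the scheme is stable in the following sense. For every $T$, every $c>0$ and every such fixed initial condition $\Phi$ there is a constant $M<\infty$ such that for all $N>0$, all time steps $\Delta t\ge c\,h^{k+1}$ and all $n\ge 0$ with $t_n\le T$, the numerical solution $\phi_n$ is periodic and of class $C^k$, $\phi_n^{(k)}$ is absolutely continuous on $[a,b]$ with $\phi_n^{(k+1)}\in L^2(\Omega)$, and $$\|\phi_n^{(\ell)}\|_{L^\infty(\Omega)}\le M\quad(0\le\ell\le k),\qquad \|\phi_n^{(k+1)}\|_{L^2(\Omega)}\le M .$$ In particular these norms remain bounded as $h\to0$. -/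

import Mathlib

open MeasureTheory Polynomial
open scoped ENNReal

namespace JetScheme

/-! ## One-dimensional Hermite interpolation -/

/-- `p` is a polynomial of degree at most `2 k + 1` with prescribed derivatives of orders
`0, …, k` at the two end points `x₀` (values `d₀`) and `x₁` (values `d₁`) of a cell. -/
def IsHermiteInterpolant (k : ℕ) (x₀ x₁ : ℝ) (d₀ d₁ : ℕ → ℝ) (p : ℝ[X]) : Prop :=
  p.natDegree ≤ 2 * k + 1 ∧
    ∀ α ≤ k, (derivative^[α] p).eval x₀ = d₀ α ∧ (derivative^[α] p).eval x₁ = d₁ α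

lemma hermite_pow_dvd (k : ℕ) (x : ℝ) (p : ℝ[X])
    (h : ∀ α ≤ k, (derivative^[α] p).eval x = 0) : (X - C x) ^ (k + 1) ∣ p := by
  by_cases hp : p = 0
  · simp [hp]
  · refine (le_rootMultiplicity_iff hp).1 ?_
    exact lt_rootMultiplicity_of_isRoot_iterate_derivative hp (fun m hm => h m hm)

lemma hermite_eq_zero (k : ℕ) {x₀ x₁ : ℝ} (hx : x₀ ≠ x₁) (p : ℝ[X])
    (hp : p.degree < ((2 * k + 2 : ℕ) : WithBot ℕ))
    (h₀ : ∀ α ≤ k, (derivative^[α] p).eval x₀ = 0)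
    (h₁ : ∀ α ≤ k, (derivative^[α] p).eval x₁ = 0) : p = 0 := by
  have hco : IsCoprime ((X - C x₀) ^ (k + 1)) ((X - C x₁) ^ (k + 1)) :=
    (isCoprime_X_sub_C_of_isUnit_sub (sub_ne_zero.2 hx).isUnit).pow
  have hd := hco.mul_dvd (hermite_pow_dvd k x₀ p h₀) (hermite_pow_dvd k x₁ p h₁)
  refine eq_zero_of_dvd_of_degree_lt hd (lt_of_lt_of_le hp ?_)
  rw [degree_mul, degree_pow, degree_pow, degree_X_sub_C, degree_X_sub_C]
  simp only [nsmul_eq_mul, mul_one]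
  norm_cast
  omega

/-- The Hermite data map on polynomials of degree less than `2 k + 2`. -/
noncomputable def hermiteData (k : ℕ) (x₀ x₁ : ℝ) :
    degreeLT ℝ (2 * k + 2) →ₗ[ℝ] (Fin (k + 1) → ℝ) × (Fin (k + 1) → ℝ) where
  toFun p := (fun α => (derivative^[(α : ℕ)] p.1).eval x₀,
    fun α => (derivative^[(α : ℕ)] p.1).eval x₁)
  map_add' p q := by
    ext α <;> simp [iterate_map_add]
  map_smul' c p := by
    ext α <;> simp [iterate_derivative_smul]

/-- For two distinct nodes the Hermite interpolation problem is uniquely solvable. -/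
theorem existsUnique_hermite (k : ℕ) {x₀ x₁ : ℝ} (hx : x₀ ≠ x₁) (d₀ d₁ : ℕ → ℝ) :
    ∃! p : ℝ[X], IsHermiteInterpolant k x₀ x₁ d₀ d₁ p := by
  have hinj : Function.Injective (hermiteData k x₀ x₁) := by
    rw [← LinearMap.ker_eq_bot, LinearMap.ker_eq_bot']
    intro p hp
    have h0 := congrArg Prod.fst hp
    have h1 := congrArg Prod.snd hp
    apply Subtype.ext
    refine hermite_eq_zero k hx p.1 (mem_degreeLT.1 p.2) ?_ ?_
    · intro α hα
      exact congrFun h0 ⟨α, by omega⟩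
    · intro α hα
      exact congrFun h1 ⟨α, by omega⟩
  have hfin : Module.finrank ℝ (degreeLT ℝ (2 * k + 2)) =
      Module.finrank ℝ ((Fin (k + 1) → ℝ) × (Fin (k + 1) → ℝ)) := by
    rw [(degreeLTEquiv ℝ (2 * k + 2)).finrank_eq]
    simp
    omega
  have : FiniteDimensional ℝ (degreeLT ℝ (2 * k + 2)) :=
    Module.Finite.equiv (degreeLTEquiv ℝ (2 * k + 2)).symm
  have hsurj := (LinearMap.injective_iff_surjective_of_finrank_eq_finrank hfin).1 hinj
  obtain ⟨p, hp⟩ := hsurj (fun α => d₀ α, fun α => d₁ α)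
  refine ⟨p.1, ⟨?_, ?_⟩, ?_⟩
  · have := mem_degreeLT.1 p.2
    by_cases h0 : p.1 = 0
    · simp [h0]
    · have := (natDegree_lt_iff_degree_lt h0).2 this
      omega
  · intro α hα
    exact ⟨congrFun (congrArg Prod.fst hp) ⟨α, by omega⟩,
      congrFun (congrArg Prod.snd hp) ⟨α, by omega⟩⟩
  · intro q hq
    rw [← sub_eq_zero]
    have hqd : q.degree < ((2 * k + 2 : ℕ) : WithBot ℕ) :=
      lt_of_le_of_lt degree_le_natDegree (by exact_mod_cast Nat.lt_succ_of_le hq.1)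
    refine hermite_eq_zero k hx (q - p.1)
      (lt_of_le_of_lt (degree_sub_le _ _) (max_lt hqd (mem_degreeLT.1 p.2))) ?_ ?_
    · intro α hα
      have : (derivative^[α] p.1).eval x₀ = d₀ α :=
        congrFun (congrArg Prod.fst hp) ⟨α, by omega⟩
      rw [iterate_derivative_sub, eval_sub, (hq.2 α hα).1, this, sub_self]
    · intro α hα
      have : (derivative^[α] p.1).eval x₁ = d₁ α :=
        congrFun (congrArg Prod.snd hp) ⟨α, by omega⟩
      rw [iterate_derivative_sub, eval_sub, (hq.2 α hα).2, this, sub_self]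

open Classical in
/-- The Hermite interpolant of degree at most `2 k + 1` for the data `d₀` at `x₀` and `d₁` at
`x₁`; the value for coinciding nodes is never used. -/
noncomputable def hermitePoly (k : ℕ) (x₀ x₁ : ℝ) (d₀ d₁ : ℕ → ℝ) : ℝ[X] :=
  if hx : x₀ ≠ x₁ then (existsUnique_hermite k hx d₀ d₁).choose else 0

theorem hermitePoly_spec (k : ℕ) {x₀ x₁ : ℝ} (hx : x₀ ≠ x₁) (d₀ d₁ : ℕ → ℝ) :
    IsHermiteInterpolant k x₀ x₁ d₀ d₁ (hermitePoly k x₀ x₁ d₀ d₁) := by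
  rw [hermitePoly, dif_pos hx]
  exact (existsUnique_hermite k hx d₀ d₁).choose_spec.1

/-! ## The projection and the advection operator -/

/-- The projection `P_k^+` in one dimension, for the grid `x_m = a + m h`, `m ∈ ℤ`.
On the cell `x_m ≤ x < x_{m+1}` the function `P_k^+ φ` is the Hermite interpolant of the
derivatives of `φ` of orders `0, …, k` at `x_m` and `x_{m+1}`.
Periodic functions on `[a, b]` are represented by their periodic extensions to `ℝ`, and `h`
is `(b - a) / N`, so that the grid is invariant under translation by the period. -/
noncomputable def projection (k : ℕ) (a h : ℝ) (φ : ℝ → ℝ) (x : ℝ) : ℝ :=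
  let m : ℤ := ⌊(x - a) / h⌋
  let x₀ : ℝ := a + m * h
  let x₁ : ℝ := a + (m + 1) * h
  (hermitePoly k x₀ x₁ (fun α => iteratedDeriv α φ x₀) (fun α => iteratedDeriv α φ x₁)).eval x

/-- A consistent Runge-Kutta scheme (explicit or implicit), given by its Butcher tableau. -/
structure RungeKuttaScheme where
  /-- number of stages -/
  s : ℕ
  /-- coefficients of the stages -/
  A : Fin s → Fin s → ℝ
  /-- weights -/
  w : Fin s → ℝ
  /-- nodes -/
  c : Fin s → ℝ
  /-- consistency -/
  sum_w : ∑ i, w i = 1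

/-- `y` results from one step of the Runge-Kutta scheme for `dx/dt = V x t`, from the point `x`
at time `τ` to time `t` (backwards in time if `t < τ`). -/
def RungeKuttaScheme.IsStep (R : RungeKuttaScheme) (V : ℝ → ℝ → ℝ) (x τ t y : ℝ) : Prop :=
  ∃ K : Fin R.s → ℝ,
    (∀ i, K i = V (x + (t - τ) * ∑ j, R.A i j * K j) (τ + R.c i * (t - τ))) ∧
      y = x + (t - τ) * ∑ i, R.w i * K i

/-- The approximate advection operator `A_{τ,t}` that belongs to the approximate
characteristics `𝒳 x τ t` (started at `x` at time `τ`, evaluated at time `t`). -/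
def advect (𝒳 : ℝ → ℝ → ℝ → ℝ) (τ t : ℝ) (g : ℝ → ℝ) (x : ℝ) : ℝ :=
  g (𝒳 x τ t)

/-- The numerical solutions `φ_n` at the times `t_n = n Δt` of the advect-and-project process:
`φ_0` is the initial condition and `φ_{n+1} = P_k^+ (A_{t_{n+1}, t_n} φ_n)`. -/
noncomputable def numericalSolution (k : ℕ) (a h Δt : ℝ) (𝒳 : ℝ → ℝ → ℝ → ℝ) (φ₀ : ℝ → ℝ) :
    ℕ → ℝ → ℝ
  | 0 => φ₀
  | n + 1 => projection k a h
      (advect 𝒳 ((n + 1 : ℕ) * Δt) (n * Δt) (numericalSolution k a h Δt 𝒳 φ₀ n))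

/-! ## Function spaces and norms -/

/-- The `L^p` norm on `[a, b]`, with values in `[0, ∞]`. -/
noncomputable def normL (a b : ℝ) (p : ℝ≥0∞) (f : ℝ → ℝ) : ℝ≥0∞ :=
  eLpNorm f p (volume.restrict (Set.Icc a b))

/-- `φ` is periodic with period `b - a`, of class `C^k`, and has a square integrable derivative
of order `k + 1`: the derivative of order `k` is absolutely continuous, and its almost everywhere
derivative is in `L^2`. -/
structure IsAdmissible (k : ℕ) (a b : ℝ) (φ : ℝ → ℝ) : Prop where
  periodic : Function.Periodic φ (b - a)
  contDiff : ContDiff ℝ k φ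
  absCont : AbsolutelyContinuousOnInterval (iteratedDeriv k φ) a b
  memLp : MemLp (iteratedDeriv (k + 1) φ) 2 (volume.restrict (Set.Icc a b))

end JetScheme

namespace JetScheme

/-! For constant velocity, consistency makes a Runge–Kutta step exact. Advection is then a
translation, which preserves, over a period, both the mean and the `L^2` norm of the derivative of
order `k + 1`.

The projection does not increase this seminorm. On each cell the interpolation error vanishes to
order `k` at both ends, so its derivative of order `k + 1` is orthogonal to all polynomials of
degree at most `k`. One of these is the derivative of order `k + 1` of the interpolant, and
Pythagoras applies (`hermite_cell_bounds`). Hence the seminorm never exceeds its initial value,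
whatever the time step.

The seminorm does not see constants, so the mean is tracked separately. One projection changes it by
at most the `L^1` interpolation error, which is `O(h^(k+1))` with a constant depending only on the
period and the initial seminorm. Since `Δt ≥ c h^(k+1)`, at most `T / (c h^(k+1))` steps are made,
and the total drift is bounded (`numericalSolution_bounds`). Derivatives of orders `1, …, k` have
mean zero by periodicity, so mean and seminorm together control the sup norms of all orders up to
`k` (`abs_iteratedDeriv_le_of_mean`). -/

/-! ### Hermite interpolation on a single cell -/

lemma iteratedDeriv_polynomial (p : ℝ[X]) (j : ℕ) :
    iteratedDeriv j (fun x => p.eval x) = fun x => (derivative^[j] p).eval x := by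
  induction j with
  | zero => simp
  | succ j ih =>
    rw [iteratedDeriv_succ, ih, Function.iterate_succ_apply']
    funext x
    exact Polynomial.deriv _

lemma contDiff_eval_polynomial (p : ℝ[X]) (n : WithTop ℕ∞) :
    ContDiff ℝ n (fun x : ℝ => p.eval x) := by
  simpa [Polynomial.coe_aeval_eq_eval] using p.contDiff_aeval (𝕜 := ℝ) n

lemma absolutelyContinuousOnInterval_polynomial (p : ℝ[X]) (x y : ℝ) :
    AbsolutelyContinuousOnInterval (fun t => p.eval t) x y := by
  apply ContDiffOn.absolutelyContinuousOnInterval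
  exact (contDiff_eval_polynomial p _).contDiffOn

/-- A function vanishing to order `k` at both ends of an interval has a derivative of order
`k + 1` that is orthogonal to the polynomials of degree at most `k`. -/
lemma integral_polynomial_mul_iteratedDeriv_eq_zero {x₀ x₁ : ℝ} {e : ℝ → ℝ} (k : ℕ) :
    ∀ q : ℝ[X], q.natDegree ≤ k →
    (∀ j ≤ k, AbsolutelyContinuousOnInterval (iteratedDeriv j e) x₀ x₁) →
    (∀ j ≤ k, iteratedDeriv j e x₀ = 0 ∧ iteratedDeriv j e x₁ = 0) →
    ∫ x in x₀..x₁, q.eval x * iteratedDeriv (k + 1) e x = 0 := by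
  induction k with
  | zero =>
    intro q hq hac he
    -- Integration by parts: the boundary terms vanish with `e`, and `q` is constant.
    rw [iteratedDeriv_succ,
      (absolutelyContinuousOnInterval_polynomial q x₀ x₁).integral_mul_deriv_eq_deriv_mul
        (hac 0 le_rfl), (he 0 le_rfl).1, (he 0 le_rfl).2]
    simp [Polynomial.deriv, derivative_of_natDegree_zero (Nat.le_zero.1 hq)]
  | succ k ih =>
    intro q hq hac he
    rw [iteratedDeriv_succ,
      (absolutelyContinuousOnInterval_polynomial q x₀ x₁).integral_mul_deriv_eq_deriv_mul
        (hac (k + 1) le_rfl), (he (k + 1) le_rfl).1, (he (k + 1) le_rfl).2]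
    simp only [Polynomial.deriv]
    rw [ih q.derivative ((natDegree_derivative_le q).trans (by omega))
      (fun j hj => hac j (by omega)) (fun j hj => he j (by omega))]
    simp

/-- Poincaré's inequality in `L^1` for functions vanishing to high order at an end point. -/
lemma integral_abs_le_pow_mul_integral_abs_iteratedDeriv {x₀ x₁ : ℝ} (h : x₀ ≤ x₁) {e : ℝ → ℝ}
    (k : ℕ) (hac : ∀ j ≤ k, AbsolutelyContinuousOnInterval (iteratedDeriv j e) x₀ x₁)
    (he : ∀ j ≤ k, iteratedDeriv j e x₀ = 0) :
    ∫ x in x₀..x₁, |e x| ≤ (x₁ - x₀) ^ (k + 1) * ∫ x in x₀..x₁, |iteratedDeriv (k + 1) e x| := by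
  have key : ∀ j ≤ k, ∫ x in x₀..x₁, |iteratedDeriv j e x| ≤
      (x₁ - x₀) * ∫ x in x₀..x₁, |iteratedDeriv (j + 1) e x| := by
    intro j hj
    have hi : IntervalIntegrable (iteratedDeriv (j + 1) e) volume x₀ x₁ := by
      rw [iteratedDeriv_succ]
      exact (hac j hj).intervalIntegrable_deriv
    have hb : ∀ x ∈ Set.Icc x₀ x₁, |iteratedDeriv j e x| ≤
        ∫ x in x₀..x₁, |iteratedDeriv (j + 1) e x| := by
      intro x hx
      have h1 : iteratedDeriv j e x = ∫ t in x₀..x, iteratedDeriv (j + 1) e t := by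
        rw [iteratedDeriv_succ, AbsolutelyContinuousOnInterval.integral_deriv_eq_sub, he j hj,
          sub_zero]
        refine (hac j hj).mono ?_
        rw [Set.uIcc_of_le hx.1, Set.uIcc_of_le h]
        exact Set.Icc_subset_Icc_right hx.2
      rw [h1]
      refine (intervalIntegral.abs_integral_le_integral_abs hx.1).trans ?_
      exact intervalIntegral.integral_mono_interval le_rfl hx.1 hx.2
        (Filter.Eventually.of_forall fun t => abs_nonneg _) hi.abs
    calc ∫ x in x₀..x₁, |iteratedDeriv j e x|
        ≤ ∫ _ in x₀..x₁, ∫ x in x₀..x₁, |iteratedDeriv (j + 1) e x| := by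
          refine intervalIntegral.integral_mono_on h ?_ (by simp) hb
          exact (hac j hj).continuousOn.abs.intervalIntegrable
      _ = _ := by simp
  have main : ∀ j ≤ k + 1, ∫ x in x₀..x₁, |e x| ≤
      (x₁ - x₀) ^ j * ∫ x in x₀..x₁, |iteratedDeriv j e x| := by
    intro j
    induction j with
    | zero => simp
    | succ j ih =>
      intro hj
      refine (ih (by omega)).trans ?_
      rw [pow_succ, mul_assoc]
      exact mul_le_mul_of_nonneg_left (key j (by omega)) (pow_nonneg (sub_nonneg.2 h) _)
  exact main (k + 1) le_rfl

lemma intervalIntegrable_of_sq {f : ℝ → ℝ} (hf : Measurable f) {x y : ℝ}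
    (h : IntervalIntegrable (fun t => f t ^ 2) volume x y) :
    IntervalIntegrable f volume x y := by
  have hc : IntervalIntegrable (fun _ : ℝ => (1 : ℝ)) volume x y := by simp
  refine (hc.add h).mono_fun hf.aestronglyMeasurable (Filter.Eventually.of_forall fun t => ?_)
  simp only [Real.norm_eq_abs]
  rw [abs_of_nonneg (a := 1 + f t ^ 2) (by positivity)]
  nlinarith [sq_abs (f t), sq_nonneg (|f t| - 1)]

/-- The pointwise bound `|f| ≤ (1 + f ^ 2) / 2` replaces Cauchy–Schwarz. The result is not
homogeneous, but it is additive over cells and a finite constant is all that is needed. -/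
lemma integral_abs_le_of_sq {f : ℝ → ℝ} (hf : Measurable f) {x y : ℝ} (hxy : x ≤ y)
    (h : IntervalIntegrable (fun t => f t ^ 2) volume x y) :
    ∫ t in x..y, |f t| ≤ ((y - x) + ∫ t in x..y, f t ^ 2) / 2 := by
  have hc : IntervalIntegrable (fun _ : ℝ => (1 : ℝ)) volume x y := by simp
  calc ∫ t in x..y, |f t| ≤ ∫ t in x..y, (1 + f t ^ 2) / 2 := by
        refine intervalIntegral.integral_mono_on hxy (intervalIntegrable_of_sq hf h).abs
          ((hc.add h).div_const 2) fun t _ => ?_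
        nlinarith [sq_abs (f t), sq_nonneg (|f t| - 1)]
    _ = _ := by
        rw [intervalIntegral.integral_div, intervalIntegral.integral_add hc h]
        simp

/-- On one cell, Hermite interpolation does not increase the `L^2` seminorm of order `k + 1`,
and its `L^1` error is of order `k + 1`. -/
theorem hermite_cell_bounds {k : ℕ} {x₀ x₁ : ℝ} (h : x₀ ≤ x₁) {ψ : ℝ → ℝ} {p : ℝ[X]}
    (hψ : ContDiff ℝ k ψ) (hac : AbsolutelyContinuousOnInterval (iteratedDeriv k ψ) x₀ x₁)
    (hsq : IntervalIntegrable (fun t => iteratedDeriv (k + 1) ψ t ^ 2) volume x₀ x₁)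
    (hp : IsHermiteInterpolant k x₀ x₁ (fun α => iteratedDeriv α ψ x₀)
      (fun α => iteratedDeriv α ψ x₁) p) :
    (∫ t in x₀..x₁, (derivative^[k + 1] p).eval t ^ 2 ≤
      ∫ t in x₀..x₁, iteratedDeriv (k + 1) ψ t ^ 2) ∧
    ∫ t in x₀..x₁, |ψ t - p.eval t| ≤
      (x₁ - x₀) ^ (k + 1) * (((x₁ - x₀) + ∫ t in x₀..x₁, iteratedDeriv (k + 1) ψ t ^ 2) / 2) := by
  set e : ℝ → ℝ := fun x => ψ x - p.eval x with he
  have hej : ∀ j ≤ k, iteratedDeriv j e =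
      fun x => iteratedDeriv j ψ x - (derivative^[j] p).eval x := by
    intro j hj
    funext x
    have hj' : (j : WithTop ℕ∞) ≤ k := by exact_mod_cast hj
    rw [← congrFun (iteratedDeriv_polynomial p j) x]
    exact iteratedDeriv_sub (hψ.of_le hj').contDiffAt (contDiff_eval_polynomial p _).contDiffAt
  have hace : ∀ j ≤ k, AbsolutelyContinuousOnInterval (iteratedDeriv j e) x₀ x₁ := by
    intro j hj
    rw [hej j hj]
    rcases hj.eq_or_lt with rfl | hlt
    · exact hac.sub (absolutelyContinuousOnInterval_polynomial _ _ _)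
    · refine AbsolutelyContinuousOnInterval.sub ?_
        (absolutelyContinuousOnInterval_polynomial _ _ _)
      refine ContDiffOn.absolutelyContinuousOnInterval (ContDiff.contDiffOn ?_)
      have h1 : ((1 + j : ℕ) : WithTop ℕ∞) ≤ k := by exact_mod_cast (by omega : 1 + j ≤ k)
      have := hψ.of_le h1
      push_cast at this
      exact ContDiff.iterate_deriv' 1 j this |> fun h => by rwa [← iteratedDeriv_eq_iterate] at h
  have hzero : ∀ j ≤ k, iteratedDeriv j e x₀ = 0 ∧ iteratedDeriv j e x₁ = 0 := by
    intro j hj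
    rw [hej j hj]
    constructor
    · simp [(hp.2 j hj).1]
    · simp [(hp.2 j hj).2]
  -- Only almost everywhere: the derivative of order `k` of `ψ` is merely absolutely continuous.
  have hae : ∀ᵐ x, x ∈ Set.uIoc x₀ x₁ → iteratedDeriv (k + 1) e x =
      iteratedDeriv (k + 1) ψ x - (derivative^[k + 1] p).eval x := by
    filter_upwards [hac.ae_differentiableAt] with x hx hm
    rw [iteratedDeriv_succ, hej k le_rfl, iteratedDeriv_succ, Function.iterate_succ_apply',
      ← Polynomial.deriv]
    exact deriv_fun_sub (hx (Set.uIoc_subset_uIcc hm)) (Polynomial.differentiableAt _)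
  set q := derivative^[k + 1] p with hq
  have hqd : q.natDegree ≤ k := (natDegree_iterate_derivative p (k + 1)).trans (by have := hp.1; omega)
  have hmψ : Measurable (iteratedDeriv (k + 1) ψ) := by
    rw [iteratedDeriv_succ]; exact measurable_deriv _
  have hme : Measurable (iteratedDeriv (k + 1) e) := by
    rw [iteratedDeriv_succ]; exact measurable_deriv _
  have hiψ := intervalIntegrable_of_sq hmψ hsq
  have hqψ : IntervalIntegrable (fun t => q.eval t * iteratedDeriv (k + 1) ψ t) volume x₀ x₁ :=
    hiψ.continuousOn_mul q.continuous.continuousOn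
  have hqq : IntervalIntegrable (fun t => q.eval t ^ 2) volume x₀ x₁ :=
    (q.continuous.pow 2).intervalIntegrable _ _
  have horth := integral_polynomial_mul_iteratedDeriv_eq_zero k q hqd hace hzero
  -- Orthogonality tested with `q` itself, the top derivative of the interpolant.
  have horth' : ∫ t in x₀..x₁, q.eval t * iteratedDeriv (k + 1) ψ t =
      ∫ t in x₀..x₁, q.eval t ^ 2 := by
    rw [← sub_eq_zero, ← intervalIntegral.integral_sub hqψ hqq, ← horth]
    refine intervalIntegral.integral_congr_ae ?_
    filter_upwards [hae] with x hx hm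
    rw [hx hm]; ring
  have hsum : IntervalIntegrable (fun t => iteratedDeriv (k + 1) ψ t ^ 2
      - 2 * (q.eval t * iteratedDeriv (k + 1) ψ t) + q.eval t ^ 2) volume x₀ x₁ :=
    (hsq.sub (hqψ.const_mul 2)).add hqq
  have hcongr : ∀ᵐ x, x ∈ Set.uIoc x₀ x₁ → iteratedDeriv (k + 1) ψ x ^ 2
      - 2 * (q.eval x * iteratedDeriv (k + 1) ψ x) + q.eval x ^ 2 =
      iteratedDeriv (k + 1) e x ^ 2 := by
    filter_upwards [hae] with x hx hm
    rw [hx hm]; ring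
  have hesq : IntervalIntegrable (fun t => iteratedDeriv (k + 1) e t ^ 2) volume x₀ x₁ :=
    hsum.congr_ae ((ae_restrict_iff' measurableSet_uIoc).2 hcongr)
  have hpyth : ∫ t in x₀..x₁, iteratedDeriv (k + 1) e t ^ 2 =
      (∫ t in x₀..x₁, iteratedDeriv (k + 1) ψ t ^ 2) - ∫ t in x₀..x₁, q.eval t ^ 2 := by
    rw [← intervalIntegral.integral_congr_ae hcongr,
      intervalIntegral.integral_add (hsq.sub (hqψ.const_mul 2)) hqq,
      intervalIntegral.integral_sub hsq (hqψ.const_mul 2), intervalIntegral.integral_const_mul,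
      horth']
    ring
  have hen : 0 ≤ ∫ t in x₀..x₁, iteratedDeriv (k + 1) e t ^ 2 :=
    intervalIntegral.integral_nonneg h fun t _ => sq_nonneg _
  have hqn : 0 ≤ ∫ t in x₀..x₁, q.eval t ^ 2 :=
    intervalIntegral.integral_nonneg h fun t _ => sq_nonneg _
  refine ⟨by linarith, ?_⟩
  refine (integral_abs_le_pow_mul_integral_abs_iteratedDeriv h k hace
    fun j hj => (hzero j hj).1).trans ?_
  refine mul_le_mul_of_nonneg_left ?_ (pow_nonneg (sub_nonneg.2 h) _)
  refine (integral_abs_le_of_sq hme h hesq).trans ?_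
  linarith

/-! ### Periodic Sobolev functions on the whole line -/

/-- Functions with period `L`, of class `C^k`, whose derivative of order `k` is the integral of a
locally square integrable function. -/
structure IsPeriodicSobolev (k : ℕ) (L : ℝ) (φ : ℝ → ℝ) : Prop where
  periodic : Function.Periodic φ L
  contDiff : ContDiff ℝ k φ
  sq_integrable : ∀ x y, IntervalIntegrable (fun t => iteratedDeriv (k + 1) φ t ^ 2) volume x y
  integral_eq : ∀ x y, ∫ t in x..y, iteratedDeriv (k + 1) φ t =
    iteratedDeriv k φ y - iteratedDeriv k φ x

lemma measurable_iteratedDeriv_succ (k : ℕ) (φ : ℝ → ℝ) :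
    Measurable (iteratedDeriv (k + 1) φ) := by
  rw [iteratedDeriv_succ]
  exact measurable_deriv _

lemma periodic_iteratedDeriv {φ : ℝ → ℝ} {L : ℝ} (h : Function.Periodic φ L) (j : ℕ) :
    Function.Periodic (iteratedDeriv j φ) L := by
  intro x
  have := congrFun (iteratedDeriv_comp_add_const (n := j) (f := φ) (s := L)) x
  rw [← this, show (fun z => φ (z + L)) = φ from funext h]

namespace IsPeriodicSobolev

variable {k : ℕ} {L : ℝ} {φ : ℝ → ℝ}

lemma intervalIntegrable_succ (h : IsPeriodicSobolev k L φ) {j : ℕ} (hj : j ≤ k) (x y : ℝ) :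
    IntervalIntegrable (iteratedDeriv (j + 1) φ) volume x y := by
  rcases hj.eq_or_lt with rfl | hlt
  · exact intervalIntegrable_of_sq (measurable_iteratedDeriv_succ _ _) (h.sq_integrable x y)
  · exact (h.contDiff.continuous_iteratedDeriv (j + 1)
      (by exact_mod_cast hlt)).intervalIntegrable _ _

lemma continuous_iteratedDeriv (h : IsPeriodicSobolev k L φ) {j : ℕ} (hj : j ≤ k) :
    Continuous (iteratedDeriv j φ) :=
  h.contDiff.continuous_iteratedDeriv j (by exact_mod_cast hj)

lemma integral_succ (h : IsPeriodicSobolev k L φ) {j : ℕ} (hj : j ≤ k) (x y : ℝ) :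
    ∫ t in x..y, iteratedDeriv (j + 1) φ t = iteratedDeriv j φ y - iteratedDeriv j φ x := by
  rcases hj.eq_or_lt with rfl | hlt
  · exact h.integral_eq x y
  · have hi := h.intervalIntegrable_succ hj x y
    rw [iteratedDeriv_succ] at hi ⊢
    exact intervalIntegral.integral_deriv_eq_sub
      (fun t _ => (h.contDiff.differentiable_iteratedDeriv j (by exact_mod_cast hlt)) t) hi

lemma absolutelyContinuous (h : IsPeriodicSobolev k L φ) (x y : ℝ) :
    AbsolutelyContinuousOnInterval (iteratedDeriv k φ) x y := by
  have h1 : iteratedDeriv k φ = fun t => iteratedDeriv k φ x +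
      ∫ s in x..t, iteratedDeriv (k + 1) φ s := by
    funext t
    rw [h.integral_eq]; ring
  rw [h1]
  have hc : AbsolutelyContinuousOnInterval (fun _ : ℝ => iteratedDeriv k φ x) x y :=
    ContDiffOn.absolutelyContinuousOnInterval contDiffOn_const
  exact hc.add ((h.intervalIntegrable_succ le_rfl x y).absolutelyContinuousOnInterval_intervalIntegral
    Set.left_mem_uIcc)

lemma comp_sub_const (h : IsPeriodicSobolev k L φ) (s : ℝ) :
    IsPeriodicSobolev k L (fun x => φ (x - s)) where
  periodic x := by simpa only [add_sub_right_comm] using h.periodic (x - s)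
  contDiff := h.contDiff.comp (contDiff_id.sub contDiff_const)
  sq_integrable x y := by
    simp only [iteratedDeriv_comp_sub_const]
    simpa using (h.sq_integrable (x - s) (y - s)).comp_sub_right s
  integral_eq x y := by
    simp only [iteratedDeriv_comp_sub_const]
    rw [intervalIntegral.integral_comp_sub_right (fun t => iteratedDeriv (k + 1) φ t), h.integral_eq]

end IsPeriodicSobolev

/-! ### The projection as a piecewise polynomial -/

/-- The Hermite interpolant of `φ` on the cell with index `m`. -/
noncomputable def cellPoly (k : ℕ) (a h : ℝ) (φ : ℝ → ℝ) (m : ℤ) : ℝ[X] :=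
  hermitePoly k (a + m * h) (a + (m + 1) * h) (fun α => iteratedDeriv α φ (a + m * h))
    (fun α => iteratedDeriv α φ (a + (m + 1) * h))

/-- The piecewise derivative of order `α` of the projection of `φ`. -/
noncomputable def piecewiseDeriv (k : ℕ) (a h : ℝ) (φ : ℝ → ℝ) (α : ℕ) (x : ℝ) : ℝ :=
  (derivative^[α] (cellPoly k a h φ ⌊(x - a) / h⌋)).eval x

section cells

variable {k : ℕ} {a h : ℝ} {φ : ℝ → ℝ}

lemma cellPoly_spec (hh : 0 < h) (m : ℤ) :
    IsHermiteInterpolant k (a + m * h) (a + (m + 1) * h)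
      (fun α => iteratedDeriv α φ (a + m * h))
      (fun α => iteratedDeriv α φ (a + (m + 1) * h)) (cellPoly k a h φ m) :=
  hermitePoly_spec k (by nlinarith) _ _

lemma floor_eq_of_mem_cell (hh : 0 < h) {m : ℤ} {x : ℝ}
    (hx : x ∈ Set.Ico (a + m * h) (a + (m + 1) * h)) : ⌊(x - a) / h⌋ = m := by
  rw [Int.floor_eq_iff, le_div_iff₀ hh, div_lt_iff₀ hh]
  constructor <;> linarith [hx.1, hx.2]

lemma mem_cell_floor (hh : 0 < h) (x : ℝ) :
    x ∈ Set.Ico (a + (⌊(x - a) / h⌋ : ℤ) * h) (a + ((⌊(x - a) / h⌋ : ℤ) + 1) * h) := by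
  have h1 := Int.floor_le ((x - a) / h)
  have h2 := Int.lt_floor_add_one ((x - a) / h)
  rw [le_div_iff₀ hh] at h1
  rw [div_lt_iff₀ hh] at h2
  constructor <;> linarith

lemma piecewiseDeriv_eq_of_mem_Ico (hh : 0 < h) (α : ℕ) {m : ℤ} {x : ℝ}
    (hx : x ∈ Set.Ico (a + m * h) (a + (m + 1) * h)) :
    piecewiseDeriv k a h φ α x = (derivative^[α] (cellPoly k a h φ m)).eval x := by
  rw [piecewiseDeriv, floor_eq_of_mem_cell hh hx]

/-- At the right end the floor already selects the next cell. The two polynomials agree there up to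
order `k` because they interpolate the same data; this matching makes the projection `C^k`. -/
lemma piecewiseDeriv_eq_of_mem_Icc (hh : 0 < h) {α : ℕ} (hα : α ≤ k) {m : ℤ} {x : ℝ}
    (hx : x ∈ Set.Icc (a + m * h) (a + (m + 1) * h)) :
    piecewiseDeriv k a h φ α x = (derivative^[α] (cellPoly k a h φ m)).eval x := by
  rcases hx.2.eq_or_lt with rfl | hlt
  · have h1 : a + ((m : ℝ) + 1) * h ∈
        Set.Ico (a + ((m + 1 : ℤ) : ℝ) * h) (a + (((m + 1 : ℤ) : ℝ) + 1) * h) := by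
      push_cast
      constructor <;> nlinarith
    have h2 := ((cellPoly_spec (k := k) (a := a) (φ := φ) hh (m + 1)).2 α hα).1
    push_cast at h2
    rw [piecewiseDeriv_eq_of_mem_Ico hh α h1, h2,
      ((cellPoly_spec (k := k) (a := a) (φ := φ) hh m).2 α hα).2]
  · exact piecewiseDeriv_eq_of_mem_Ico hh α ⟨hx.1, hlt⟩

lemma projection_eq_piecewiseDeriv : projection k a h φ = piecewiseDeriv k a h φ 0 := rfl

/-- One-sided differentiability on all cells of a grid gives differentiability. -/
lemma hasDerivAt_of_cells (hh : 0 < h) {f f' : ℝ → ℝ}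
    (H : ∀ m : ℤ, ∀ x ∈ Set.Icc (a + m * h) (a + (m + 1) * h),
      HasDerivWithinAt f (f' x) (Set.Icc (a + m * h) (a + (m + 1) * h)) x) (x : ℝ) :
    HasDerivAt f (f' x) x := by
  have hx := mem_cell_floor (a := a) hh x
  set m := ⌊(x - a) / h⌋
  rcases hx.1.eq_or_lt with heq | hlt
  · have h1 := H m x ⟨hx.1, hx.2.le⟩
    have hc : ((m - 1 : ℤ) : ℝ) + 1 = m := by push_cast; ring
    have h2 := H (m - 1) x ⟨by push_cast; nlinarith, by rw [hc]; exact heq.ge⟩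
    rw [hc] at h2
    refine (h2.union h1).hasDerivAt ?_
    rw [Set.Icc_union_Icc_eq_Icc (by push_cast; nlinarith) (by nlinarith)]
    exact Icc_mem_nhds (by push_cast; nlinarith) hx.2
  · exact (H m x ⟨hx.1, hx.2.le⟩).hasDerivAt (Icc_mem_nhds hlt hx.2)

/-- Continuity on all cells of a grid gives continuity. -/
lemma continuous_of_cells (hh : 0 < h) {f : ℝ → ℝ}
    (H : ∀ m : ℤ, ContinuousOn f (Set.Icc (a + m * h) (a + (m + 1) * h))) : Continuous f := by
  rw [continuous_iff_continuousAt]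
  intro x
  have hx := mem_cell_floor (a := a) hh x
  set m := ⌊(x - a) / h⌋
  rcases hx.1.eq_or_lt with heq | hlt
  · have h1 := H m x ⟨hx.1, hx.2.le⟩
    have hc : ((m - 1 : ℤ) : ℝ) + 1 = m := by push_cast; ring
    have h2 := H (m - 1) x ⟨by push_cast; nlinarith, by rw [hc]; exact heq.ge⟩
    rw [hc] at h2
    refine (h2.union h1).continuousAt ?_
    rw [Set.Icc_union_Icc_eq_Icc (by push_cast; nlinarith) (by nlinarith)]
    exact Icc_mem_nhds (by push_cast; nlinarith) hx.2
  · exact (H m x ⟨hx.1, hx.2.le⟩).continuousAt (Icc_mem_nhds hlt hx.2)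

lemma continuous_piecewiseDeriv (hh : 0 < h) {α : ℕ} (hα : α ≤ k) :
    Continuous (piecewiseDeriv k a h φ α) :=
  continuous_of_cells hh fun _ => (Polynomial.continuous _).continuousOn.congr
    fun _ hx => piecewiseDeriv_eq_of_mem_Icc hh hα hx

lemma hasDerivAt_piecewiseDeriv (hh : 0 < h) {α : ℕ} (hα : α < k) (x : ℝ) :
    HasDerivAt (piecewiseDeriv k a h φ α) (piecewiseDeriv k a h φ (α + 1) x) x := by
  refine hasDerivAt_of_cells (a := a) hh (fun m x hx => ?_) x
  rw [piecewiseDeriv_eq_of_mem_Icc hh hα hx, Function.iterate_succ_apply']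
  exact (Polynomial.hasDerivAt _ _).hasDerivWithinAt.congr
    (fun y hy => piecewiseDeriv_eq_of_mem_Icc hh hα.le hy)
    (piecewiseDeriv_eq_of_mem_Icc hh hα.le hx)

lemma hasDerivAt_piecewiseDeriv_of_mem_Ioo (hh : 0 < h) (α : ℕ) {m : ℤ} {x : ℝ}
    (hx : x ∈ Set.Ioo (a + m * h) (a + (m + 1) * h)) :
    HasDerivAt (piecewiseDeriv k a h φ α)
      ((derivative^[α + 1] (cellPoly k a h φ m)).eval x) x := by
  rw [Function.iterate_succ_apply']
  refine (Polynomial.hasDerivAt _ _).congr_of_eventuallyEq ?_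
  filter_upwards [Ioo_mem_nhds hx.1 hx.2] with y hy
  exact piecewiseDeriv_eq_of_mem_Ico hh α ⟨hy.1.le, hy.2⟩

lemma iteratedDeriv_projection (hh : 0 < h) {α : ℕ} (hα : α ≤ k) :
    iteratedDeriv α (projection k a h φ) = piecewiseDeriv k a h φ α := by
  induction α with
  | zero => rw [iteratedDeriv_zero, projection_eq_piecewiseDeriv]
  | succ α ih =>
    rw [iteratedDeriv_succ, ih (by omega)]
    funext x
    exact (hasDerivAt_piecewiseDeriv hh (by omega) x).deriv

lemma iteratedDeriv_succ_projection (hh : 0 < h) {m : ℤ} {x : ℝ}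
    (hx : x ∈ Set.Ioo (a + m * h) (a + (m + 1) * h)) :
    iteratedDeriv (k + 1) (projection k a h φ) x =
      (derivative^[k + 1] (cellPoly k a h φ m)).eval x := by
  rw [iteratedDeriv_succ, iteratedDeriv_projection hh le_rfl]
  exact (hasDerivAt_piecewiseDeriv_of_mem_Ioo hh k hx).deriv

lemma contDiff_projection (hh : 0 < h) : ContDiff ℝ k (projection k a h φ) := by
  rw [contDiff_nat_iff_iteratedDeriv]
  refine ⟨fun m hm => ?_, fun m hm => ?_⟩
  · rw [iteratedDeriv_projection hh hm]
    exact continuous_piecewiseDeriv hh hm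
  · rw [iteratedDeriv_projection hh hm.le]
    exact fun x => (hasDerivAt_piecewiseDeriv hh hm x).differentiableAt

/-- The translated polynomial solves the interpolation problem of the translated cell, whose
solution is unique. -/
lemma cellPoly_add (hh : 0 < h) {N : ℕ} (hφ : Function.Periodic φ (N * h)) (m : ℤ) :
    cellPoly k a h φ (m + N) = (cellPoly k a h φ m).comp (X - C (N * h)) := by
  have hx : a + ((m + N : ℤ) : ℝ) * h ≠ a + (((m + N : ℤ) : ℝ) + 1) * h := by nlinarith
  refine (existsUnique_hermite k hx _ _).unique (cellPoly_spec hh (m + N)) ?_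
  have hs := cellPoly_spec (k := k) (a := a) (φ := φ) hh m
  have hcomp : ∀ (α : ℕ) (p : ℝ[X]), derivative^[α] (p.comp (X - C (N * h))) =
      (derivative^[α] p).comp (X - C (N * h)) := by
    intro α
    induction α with
    | zero => simp
    | succ α ih => 
      intro p
      rw [Function.iterate_succ_apply, Function.iterate_succ_apply, ← ih, derivative_comp,
        derivative_X_sub_C, one_mul]
  refine ⟨?_, fun α hα => ?_⟩
  · rw [natDegree_comp, natDegree_X_sub_C, mul_one]
    exact hs.1
  · have h0 : a + ((m + N : ℤ) : ℝ) * h = (a + m * h) + N * h := by push_cast; ring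
    have h1 : a + (((m + N : ℤ) : ℝ) + 1) * h = (a + (m + 1) * h) + N * h := by push_cast; ring
    rw [hcomp, eval_comp, eval_comp, h0, h1]
    have hper := periodic_iteratedDeriv hφ α
    simp only [eval_sub, eval_X, eval_C, add_sub_cancel_right]
    rw [hper, hper]
    exact hs.2 α hα

lemma periodic_projection (hh : 0 < h) {N : ℕ} (hφ : Function.Periodic φ (N * h)) :
    Function.Periodic (projection k a h φ) (N * h) := by
  intro x
  rw [projection_eq_piecewiseDeriv]
  have hfl : ⌊(x + N * h - a) / h⌋ = ⌊(x - a) / h⌋ + N := by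
    rw [show (x + N * h - a) / h = (x - a) / h + (N : ℕ) by field_simp; ring,
      Int.floor_add_natCast]
  simp [piecewiseDeriv, hfl, cellPoly_add hh hφ, eval_comp]

lemma isPeriodicSobolev_projection (hh : 0 < h) {N : ℕ} (hN : 0 < N)
    (hφ : Function.Periodic φ (N * h)) :
    IsPeriodicSobolev k (N * h) (projection k a h φ) := by
  have hper := periodic_projection (k := k) (a := a) hh hφ
  have hsq : ∀ x y, IntervalIntegrable
      (fun t => iteratedDeriv (k + 1) (projection k a h φ) t ^ 2) volume x y := by
    have hp2 : Function.Periodic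
        (fun t => iteratedDeriv (k + 1) (projection k a h φ) t ^ 2) (N * h) := fun x => by
      simp only [periodic_iteratedDeriv hper (k + 1) x]
    have hpos : (N : ℝ) * h ≠ 0 := by positivity
    refine hp2.intervalIntegrable hpos (t := a) ?_
    have := IntervalIntegrable.trans_iterate (μ := volume)
      (f := fun t => iteratedDeriv (k + 1) (projection k a h φ) t ^ 2)
      (a := fun i : ℕ => a + i * h) (n := N) ?_
    · simpa using this
    · intro i _
      have hc : IntervalIntegrable
          (fun t => (derivative^[k + 1] (cellPoly k a h φ (i : ℤ))).eval t ^ 2) volume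
          (a + i * h) (a + (i + 1 : ℕ) * h) :=
        ((Polynomial.continuous _).pow 2).intervalIntegrable _ _
      refine hc.congr_uIoo fun x hx => ?_
      rw [Set.uIoo_of_le (by push_cast; nlinarith)] at hx
      have hx' : x ∈ Set.Ioo (a + ((i : ℤ) : ℝ) * h) (a + (((i : ℤ) : ℝ) + 1) * h) := by
        simpa using hx
      simp only [iteratedDeriv_succ_projection hh hx']
  refine ⟨hper, contDiff_projection hh, hsq, fun x y => ?_⟩
  have hmeas := measurable_iteratedDeriv_succ k (projection k a h φ)
  -- The derivative of order `k` is continuous and can fail to be differentiable only at the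
  -- countably many grid points.
  refine integral_eq_of_hasDerivAt_off_countable _ _
    (s := Set.range fun m : ℤ => a + m * h) (Set.countable_range _) ?_ ?_
    (intervalIntegrable_of_sq hmeas (hsq x y))
  · rw [iteratedDeriv_projection hh le_rfl]
    exact (continuous_piecewiseDeriv hh le_rfl).continuousOn
  · rintro t ⟨_, ht⟩
    have hm := mem_cell_floor (a := a) hh t
    have hm' : t ∈ Set.Ioo (a + (⌊(t - a) / h⌋ : ℤ) * h) (a + ((⌊(t - a) / h⌋ : ℤ) + 1) * h) :=
      ⟨lt_of_le_of_ne hm.1 fun he => ht ⟨_, he⟩, hm.2⟩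
    rw [iteratedDeriv_succ_projection hh hm', iteratedDeriv_projection hh le_rfl]
    exact hasDerivAt_piecewiseDeriv_of_mem_Ioo hh k hm'

/-- The projection does not increase the `L^2` seminorm of order `k + 1`, and its `L^1` error
over a period is of order `k + 1`. -/
theorem projection_bounds (hh : 0 < h) {N : ℕ} (hN : 0 < N) (hφ : IsPeriodicSobolev k (N * h) φ) :
    (∫ t in a..a + N * h, iteratedDeriv (k + 1) (projection k a h φ) t ^ 2 ≤
      ∫ t in a..a + N * h, iteratedDeriv (k + 1) φ t ^ 2) ∧
    ∫ t in a..a + N * h, |φ t - projection k a h φ t| ≤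
      h ^ (k + 1) * ((N * h + ∫ t in a..a + N * h, iteratedDeriv (k + 1) φ t ^ 2) / 2) := by
  have hP := isPeriodicSobolev_projection (k := k) (a := a) hh hN hφ.periodic
  have hsplit : ∀ f : ℝ → ℝ, (∀ x y, IntervalIntegrable f volume x y) →
      ∫ t in a..a + N * h, f t =
        ∑ i ∈ Finset.range N, ∫ t in (a + (i : ℤ) * h)..(a + ((i : ℤ) + 1) * h), f t := by
    intro f hf
    have := intervalIntegral.sum_integral_adjacent_intervals (f := f) (μ := volume)
      (a := fun i : ℕ => a + i * h) (n := N) fun i _ => hf _ _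
    simpa using this.symm
  have hle : ∀ i : ℕ, a + ((i : ℤ) : ℝ) * h ≤ a + (((i : ℤ) : ℝ) + 1) * h := fun i => by nlinarith
  have hcell := fun i : ℕ => hermite_cell_bounds (hle i) hφ.contDiff
    (hφ.absolutelyContinuous _ _) (hφ.sq_integrable _ _) (cellPoly_spec (φ := φ) hh (i : ℤ))
  have hlen : ∀ i : ℕ, a + (((i : ℤ) : ℝ) + 1) * h - (a + ((i : ℤ) : ℝ) * h) = h :=
    fun i => by ring
  constructor
  · rw [hsplit _ hP.sq_integrable, hsplit _ hφ.sq_integrable]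
    refine Finset.sum_le_sum fun i _ => ?_
    refine le_trans (le_of_eq ?_) (hcell i).1
    refine intervalIntegral.integral_congr_Ioo_of_le (hle i) fun x hx => ?_
    simp only [iteratedDeriv_succ_projection hh hx]
  · have hcont : Continuous fun t => |φ t - projection k a h φ t| :=
      (hφ.contDiff.continuous.sub hP.contDiff.continuous).abs
    rw [hsplit _ fun x y => hcont.intervalIntegrable x y, hsplit _ hφ.sq_integrable]
    have hr : h ^ (k + 1) * ((N * h + ∑ i ∈ Finset.range N,
        ∫ t in (a + (i : ℤ) * h)..(a + ((i : ℤ) + 1) * h), iteratedDeriv (k + 1) φ t ^ 2) / 2) =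
        ∑ i ∈ Finset.range N, h ^ (k + 1) * ((h +
          ∫ t in (a + (i : ℤ) * h)..(a + ((i : ℤ) + 1) * h),
            iteratedDeriv (k + 1) φ t ^ 2) / 2) := by
      rw [← Finset.mul_sum, ← Finset.sum_div, Finset.sum_add_distrib]
      simp
    rw [hr]
    refine Finset.sum_le_sum fun i _ => ?_
    have h2 := (hcell i).2
    rw [hlen i] at h2
    refine le_trans (le_of_eq ?_) h2
    refine intervalIntegral.integral_congr_Ioo_of_le (hle i) fun x hx => ?_
    simp only [projection_eq_piecewiseDeriv,
      piecewiseDeriv_eq_of_mem_Ico hh 0 ⟨hx.1.le, hx.2⟩, Function.iterate_zero, id]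

end cells

/-! ### From one period to the line, and sup norm bounds -/

lemma IsAdmissible.isPeriodicSobolev {k : ℕ} {a b : ℝ} (hab : a < b) {φ : ℝ → ℝ}
    (h : IsAdmissible k a b φ) : IsPeriodicSobolev k (b - a) φ := by
  have hL : b - a ≠ 0 := (sub_pos.2 hab).ne'
  have hper := periodic_iteratedDeriv h.periodic (k + 1)
  have hmeas := measurable_iteratedDeriv_succ k φ
  have hsq : ∀ x y, IntervalIntegrable (fun t => iteratedDeriv (k + 1) φ t ^ 2) volume x y := by
    have hp2 : Function.Periodic (fun t => iteratedDeriv (k + 1) φ t ^ 2) (b - a) := fun x => by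
      simp only [hper x]
    refine hp2.intervalIntegrable hL (t := a) ?_
    rw [add_sub_cancel, intervalIntegrable_iff_integrableOn_Icc_of_le hab.le]
    exact (memLp_two_iff_integrable_sq hmeas.aestronglyMeasurable).1 h.memLp
  have hint : ∀ x y, IntervalIntegrable (iteratedDeriv (k + 1) φ) volume x y :=
    fun x y => intervalIntegrable_of_sq hmeas (hsq x y)
  have hac : ∀ y ∈ Set.Icc a b, ∫ t in a..y, iteratedDeriv (k + 1) φ t =
      iteratedDeriv k φ y - iteratedDeriv k φ a := by
    intro y hy
    rw [iteratedDeriv_succ]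
    refine (h.absCont.mono ?_).integral_deriv_eq_sub
    rw [Set.uIcc_of_le hy.1, Set.uIcc_of_le hab.le]
    exact Set.Icc_subset_Icc_right hy.2
  have hkper := periodic_iteratedDeriv h.periodic k
  -- The integral over a full period vanishes, so this difference is periodic. Being constant on
  -- `[a, b]`, it is constant everywhere.
  have hF : Function.Periodic (fun y => (∫ t in a..y, iteratedDeriv (k + 1) φ t) -
      iteratedDeriv k φ y) (b - a) := by
    intro y
    simp only
    rw [hkper y, hper.intervalIntegral_add_eq_add a y hint, add_sub_cancel,
      hac b ⟨hab.le, le_rfl⟩]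
    have : iteratedDeriv k φ b = iteratedDeriv k φ a := by
      have := hkper a
      rwa [add_sub_cancel] at this
    rw [this]; ring
  have hall : ∀ y, ∫ t in a..y, iteratedDeriv (k + 1) φ t =
      iteratedDeriv k φ y - iteratedDeriv k φ a := by
    intro y
    obtain ⟨z, hz, hyz⟩ := hF.exists_mem_Ico (sub_pos.2 hab) y a
    rw [add_sub_cancel] at hz
    rw [hac z ⟨hz.1, hz.2.le⟩] at hyz
    linarith
  refine ⟨h.periodic, h.contDiff, hsq, fun x y => ?_⟩
  rw [← intervalIntegral.integral_interval_sub_left (hint a y) (hint a x), hall, hall]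
  ring

namespace IsPeriodicSobolev

variable {k : ℕ} {L : ℝ} {φ : ℝ → ℝ}

lemma isAdmissible {a b : ℝ} (hab : a < b) (h : IsPeriodicSobolev k (b - a) φ) :
    IsAdmissible k a b φ := by
  refine ⟨h.periodic, h.contDiff, h.absolutelyContinuous a b, ?_⟩
  rw [memLp_two_iff_integrable_sq (measurable_iteratedDeriv_succ k φ).aestronglyMeasurable]
  exact (intervalIntegrable_iff_integrableOn_Icc_of_le hab.le).1 (h.sq_integrable a b)

/-- Two values within a period differ by at most the `L^1` norm of the next derivative; averaging
over the second point compares a value with the mean. -/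
lemma abs_iteratedDeriv_le (h : IsPeriodicSobolev k L φ) (hL : 0 < L) {a : ℝ} {j : ℕ}
    (hj : j ≤ k) {x : ℝ} (hx : x ∈ Set.Icc a (a + L)) :
    |iteratedDeriv j φ x| ≤ (∫ t in a..a + L, |iteratedDeriv (j + 1) φ t|) +
      |∫ t in a..a + L, iteratedDeriv j φ t| / L := by
  have hle : a ≤ a + L := by linarith
  set S := ∫ t in a..a + L, |iteratedDeriv (j + 1) φ t|
  have hint := (h.intervalIntegrable_succ hj a (a + L)).abs
  have hb : ∀ y ∈ Set.uIoc a (a + L), ‖iteratedDeriv j φ x - iteratedDeriv j φ y‖ ≤ S := by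
    intro y hy
    rw [← h.integral_succ hj y x, intervalIntegral.norm_integral_eq_norm_integral_uIoc]
    refine (norm_integral_le_integral_norm _).trans ?_
    rw [Set.uIoc_of_le hle] at hy
    have hS : S = ∫ t in Set.Ioc a (a + L), ‖iteratedDeriv (j + 1) φ t‖ := by
      simp only [S, intervalIntegral.integral_of_le hle, Real.norm_eq_abs]
    rw [hS]
    refine setIntegral_mono_set ?_ (Filter.Eventually.of_forall fun t => norm_nonneg _) ?_
    · exact (intervalIntegrable_iff_integrableOn_Ioc_of_le hle).1 hint
    · refine Filter.Eventually.of_forall (Set.Ioc_subset_Ioc ?_ ?_)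
      · exact le_min hy.1.le hx.1
      · exact max_le hy.2 hx.2
  have h1 := intervalIntegral.norm_integral_le_of_norm_le_const hb
  have hc := h.continuous_iteratedDeriv hj
  rw [intervalIntegral.integral_sub (by simp) (hc.intervalIntegrable _ _)] at h1
  simp only [intervalIntegral.integral_const, add_sub_cancel_left, smul_eq_mul, abs_of_pos hL,
    Real.norm_eq_abs] at h1
  set m := ∫ t in a..a + L, iteratedDeriv j φ t
  have h2 : L * |iteratedDeriv j φ x| ≤ S * L + |m| := by
    calc L * |iteratedDeriv j φ x| = |L * iteratedDeriv j φ x| := by rw [abs_mul, abs_of_pos hL]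
      _ = |(L * iteratedDeriv j φ x - m) + m| := by rw [sub_add_cancel]
      _ ≤ |L * iteratedDeriv j φ x - m| + |m| := abs_add_le _ _
      _ ≤ _ := by linarith
  have h3 : S + |m| / L = (S * L + |m|) / L := by field_simp
  rw [h3, le_div_iff₀ hL]
  linarith

lemma integral_period_succ (h : IsPeriodicSobolev k L φ) (a : ℝ) {j : ℕ} (hj : j ≤ k) :
    ∫ t in a..a + L, iteratedDeriv (j + 1) φ t = 0 := by
  rw [h.integral_succ hj, periodic_iteratedDeriv h.periodic j a, sub_self]

lemma integral_abs_iteratedDeriv_le (h : IsPeriodicSobolev k L φ) (hL : 0 < L) (a : ℝ) (i : ℕ)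
    (hi : i ≤ k) : ∫ t in a..a + L, |iteratedDeriv (k - i + 1) φ t| ≤
      L ^ i * ∫ t in a..a + L, |iteratedDeriv (k + 1) φ t| := by
  have hle : a ≤ a + L := by linarith
  induction i with
  | zero => simp
  | succ i ih =>
    obtain ⟨j, hj⟩ : ∃ j, k - i = j + 1 := ⟨k - i - 1, by omega⟩
    have hj' : k - (i + 1) = j := by omega
    have ih := ih (by omega)
    rw [hj] at ih
    rw [hj']
    -- The order `j + 1` is positive, so the mean is zero and its term drops out.
    have hb : ∀ x ∈ Set.Icc a (a + L), |iteratedDeriv (j + 1) φ x| ≤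
        ∫ t in a..a + L, |iteratedDeriv (j + 1 + 1) φ t| := by
      intro x hx
      have := h.abs_iteratedDeriv_le hL (j := j + 1) (by omega) hx
      rwa [h.integral_period_succ a (by omega), abs_zero, zero_div, add_zero] at this
    calc ∫ t in a..a + L, |iteratedDeriv (j + 1) φ t|
        ≤ ∫ _ in a..a + L, ∫ t in a..a + L, |iteratedDeriv (j + 1 + 1) φ t| :=
          intervalIntegral.integral_mono_on hle
            (h.intervalIntegrable_succ (by omega) _ _).abs (by simp) hb
      _ = L * ∫ t in a..a + L, |iteratedDeriv (j + 1 + 1) φ t| := by simp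
      _ ≤ L * (L ^ i * ∫ t in a..a + L, |iteratedDeriv (k + 1) φ t|) :=
          mul_le_mul_of_nonneg_left ih hL.le
      _ = _ := by ring

/-- A bound on all lower derivatives by the mean value and the derivative of order `k + 1`. -/
lemma abs_iteratedDeriv_le_of_mean (h : IsPeriodicSobolev k L φ) (hL : 0 < L) {a : ℝ} {j : ℕ}
    (hj : j ≤ k) {x : ℝ} (hx : x ∈ Set.Icc a (a + L)) :
    |iteratedDeriv j φ x| ≤
      (1 + L) ^ k * ((L + ∫ t in a..a + L, iteratedDeriv (k + 1) φ t ^ 2) / 2) +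
      |∫ t in a..a + L, φ t| / L := by
  have hle : a ≤ a + L := by linarith
  have h1 := h.abs_iteratedDeriv_le hL hj hx
  have h2 := h.integral_abs_iteratedDeriv_le hL a (k - j) (by omega)
  rw [show k - (k - j) = j by omega] at h2
  have h3 := integral_abs_le_of_sq (measurable_iteratedDeriv_succ k φ) hle
    (h.sq_integrable a (a + L))
  rw [add_sub_cancel_left] at h3
  have h0 : 0 ≤ ∫ t in a..a + L, |iteratedDeriv (k + 1) φ t| :=
    intervalIntegral.integral_nonneg hle fun t _ => abs_nonneg _
  have hpow : L ^ (k - j) ≤ (1 + L) ^ k :=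
    (pow_le_pow_left₀ hL.le (by linarith) _).trans
      (pow_le_pow_right₀ (by linarith) (by omega))
  have h4 := mul_le_mul hpow h3 h0 (by positivity)
  have h5 : |∫ t in a..a + L, iteratedDeriv j φ t| / L ≤ |∫ t in a..a + L, φ t| / L := by
    -- Only order zero can have a nonzero mean.
    rcases j with _ | j
    · simp
    · rw [h.integral_period_succ a (by omega), abs_zero, zero_div]
      positivity
  linarith

end IsPeriodicSobolev

/-! ### Evolution of seminorm and mean along the scheme -/

lemma RungeKuttaScheme.IsStep.eq_of_const {R : RungeKuttaScheme} {v x τ t y : ℝ}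
    (h : R.IsStep (fun _ _ => v) x τ t y) : y = x + (t - τ) * v := by
  obtain ⟨K, hK, rfl⟩ := h
  simp only [hK, ← Finset.sum_mul, R.sum_w, one_mul]

lemma numericalSolution_succ {R : RungeKuttaScheme} {v : ℝ} {𝒳 : ℝ → ℝ → ℝ → ℝ}
    (h𝒳 : ∀ x τ t : ℝ, R.IsStep (fun _ _ => v) x τ t (𝒳 x τ t)) (k : ℕ) (a h Δt : ℝ)
    (φ₀ : ℝ → ℝ) (n : ℕ) :
    numericalSolution k a h Δt 𝒳 φ₀ (n + 1) =
      projection k a h (fun x => numericalSolution k a h Δt 𝒳 φ₀ n (x - Δt * v)) := by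
  rw [numericalSolution]
  congr 1
  funext x
  rw [advect, (h𝒳 _ _ _).eq_of_const]
  congr 1
  push_cast
  ring

lemma integral_period_comp_sub {f : ℝ → ℝ} {L : ℝ} (hf : Function.Periodic f L) (a s : ℝ) :
    ∫ t in a..a + L, f (t - s) = ∫ t in a..a + L, f t := by
  rw [intervalIntegral.integral_comp_sub_right f, add_sub_right_comm,
    hf.intervalIntegral_add_eq (a - s) a]

/-- The seminorm of order `k + 1` does not increase along the jet scheme, and the mean value
changes by `O(h^{k+1})` in each step. -/
theorem numericalSolution_bounds {R : RungeKuttaScheme} {v : ℝ} {𝒳 : ℝ → ℝ → ℝ → ℝ}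
    (h𝒳 : ∀ x τ t : ℝ, R.IsStep (fun _ _ => v) x τ t (𝒳 x τ t)) {k : ℕ} {a h : ℝ} (Δt : ℝ)
    (hh : 0 < h) {N : ℕ} (hN : 0 < N) {φ₀ : ℝ → ℝ} (hφ₀ : IsPeriodicSobolev k (N * h) φ₀)
    (n : ℕ) :
    IsPeriodicSobolev k (N * h) (numericalSolution k a h Δt 𝒳 φ₀ n) ∧
    ∫ t in a..a + N * h, iteratedDeriv (k + 1) (numericalSolution k a h Δt 𝒳 φ₀ n) t ^ 2 ≤
      ∫ t in a..a + N * h, iteratedDeriv (k + 1) φ₀ t ^ 2 ∧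
    |∫ t in a..a + N * h, numericalSolution k a h Δt 𝒳 φ₀ n t| ≤
      |∫ t in a..a + N * h, φ₀ t| + n * h ^ (k + 1) *
        ((N * h + ∫ t in a..a + N * h, iteratedDeriv (k + 1) φ₀ t ^ 2) / 2) := by
  induction n with
  | zero =>
    rw [numericalSolution]
    exact ⟨hφ₀, le_rfl, by simp⟩
  | succ n ih =>
    obtain ⟨hps, hI, hmean⟩ := ih
    rw [numericalSolution_succ h𝒳]
    set φ := numericalSolution k a h Δt 𝒳 φ₀ n
    have hψ := hps.comp_sub_const (Δt * v)
    set ψ : ℝ → ℝ := fun x => φ (x - Δt * v) with hψd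
    have hP := isPeriodicSobolev_projection (k := k) (a := a) hh hN hψ.periodic
    have hIψ : ∫ t in a..a + N * h, iteratedDeriv (k + 1) ψ t ^ 2 =
        ∫ t in a..a + N * h, iteratedDeriv (k + 1) φ t ^ 2 := by
      rw [hψd, iteratedDeriv_comp_sub_const]
      exact integral_period_comp_sub (f := fun t => iteratedDeriv (k + 1) φ t ^ 2)
        (fun x => by simp only [periodic_iteratedDeriv hps.periodic (k + 1) x]) _ _
    have hmψ : ∫ t in a..a + N * h, ψ t = ∫ t in a..a + N * h, φ t :=
      integral_period_comp_sub hps.periodic _ _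
    obtain ⟨h1, h2⟩ := projection_bounds (a := a) hh hN hψ
    refine ⟨hP, h1.trans (hIψ.le.trans hI), ?_⟩
    have hle : a ≤ a + N * h := le_add_of_nonneg_right (by positivity)
    -- Translation keeps the mean, so only the interpolation error contributes to its drift.
    have hdiff : |(∫ t in a..a + N * h, projection k a h ψ t) - ∫ t in a..a + N * h, φ t| ≤
        ∫ t in a..a + N * h, |ψ t - projection k a h ψ t| := by
      rw [← hmψ, abs_sub_comm, ← intervalIntegral.integral_sub
        (hψ.contDiff.continuous.intervalIntegrable _ _)
        (hP.contDiff.continuous.intervalIntegrable _ _)]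
      exact intervalIntegral.abs_integral_le_integral_abs hle
    have hstep : h ^ (k + 1) *
        ((N * h + ∫ t in a..a + N * h, iteratedDeriv (k + 1) ψ t ^ 2) / 2) ≤
        h ^ (k + 1) * ((N * h + ∫ t in a..a + N * h, iteratedDeriv (k + 1) φ₀ t ^ 2) / 2) := by
      rw [hIψ]
      gcongr
    have htri := abs_add_le
      ((∫ t in a..a + N * h, projection k a h ψ t) - ∫ t in a..a + N * h, φ t)
      (∫ t in a..a + N * h, φ t)
    rw [sub_add_cancel] at htri
    push_cast
    linarith

/-! ### Conversion to `L^p` norms and the stability theorem -/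

lemma normL_top_le {a b C : ℝ} {f : ℝ → ℝ} (h : ∀ x ∈ Set.Icc a b, |f x| ≤ C) :
    normL a b ⊤ f ≤ ENNReal.ofReal C := by
  rw [normL, eLpNorm_exponent_top]
  refine eLpNormEssSup_le_of_ae_bound ?_
  filter_upwards [ae_restrict_mem measurableSet_Icc] with x hx
  exact h x hx

lemma normL_two_le {a b D : ℝ} (hab : a ≤ b) {f : ℝ → ℝ}
    (hf : MemLp f 2 (volume.restrict (Set.Icc a b))) (h : ∫ t in a..b, f t ^ 2 ≤ D) :
    normL a b 2 f ≤ ENNReal.ofReal (Real.sqrt D) := by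
  rw [normL, hf.eLpNorm_eq_integral_rpow_norm (by norm_num) (by norm_num)]
  refine ENNReal.ofReal_le_ofReal ?_
  rw [Real.sqrt_eq_rpow, ENNReal.toReal_ofNat, one_div]
  refine Real.rpow_le_rpow (integral_nonneg fun t => by positivity) ?_ (by norm_num)
  rw [intervalIntegral.integral_of_le hab, ← integral_Icc_eq_integral_Ioc] at h
  simpa using h

end JetScheme

theorem mainTheorem6 (k : ℕ) (a b : ℝ) (hab : a < b) (v : ℝ)
    (R : JetScheme.RungeKuttaScheme) (𝒳 : ℝ → ℝ → ℝ → ℝ)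
    (h𝒳 : ∀ x τ t : ℝ, R.IsStep (fun _ _ => v) x τ t (𝒳 x τ t))
    (φ₀ : ℝ → ℝ) (hφ₀ : JetScheme.IsAdmissible k a b φ₀)
    (T c : ℝ) (hc : 0 < c) :
    ∃ M : NNReal, ∀ N : ℕ, 0 < N → ∀ Δt : ℝ, c * ((b - a) / N) ^ (k + 1) ≤ Δt →
      ∀ n : ℕ, n * Δt ≤ T →
        JetScheme.IsAdmissible k a b
          (JetScheme.numericalSolution k a ((b - a) / N) Δt 𝒳 φ₀ n) ∧
        (∀ ℓ ≤ k, JetScheme.normL a b ⊤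
          (iteratedDeriv ℓ (JetScheme.numericalSolution k a ((b - a) / N) Δt 𝒳 φ₀ n)) ≤ M) ∧
        JetScheme.normL a b 2
          (iteratedDeriv (k + 1) (JetScheme.numericalSolution k a ((b - a) / N) Δt 𝒳 φ₀ n)) ≤ M
    := by
  have hL : 0 < b - a := sub_pos.2 hab
  set L := b - a with hLd
  have hb : a + L = b := add_sub_cancel _ _
  set D := ∫ t in a..a + L, iteratedDeriv (k + 1) φ₀ t ^ 2 with hD
  -- The bound of `abs_iteratedDeriv_le_of_mean`, with the mean's integral replaced by its initial
  -- size plus the drift: `T / c` bounds `n h^(k+1)`, and `(L + D) / 2` is the error constant of one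
  -- step.
  set B := (1 + L) ^ k * ((L + D) / 2) +
    (|∫ t in a..a + L, φ₀ t| + T / c * ((L + D) / 2)) / L with hB
  have hD0 : 0 ≤ D := intervalIntegral.integral_nonneg (by linarith) fun t _ => sq_nonneg _
  refine ⟨(max B (Real.sqrt D)).toNNReal, fun N hN Δt hΔt n hn => ?_⟩
  have hN' : (0 : ℝ) < N := by exact_mod_cast hN
  have hh : 0 < L / N := by positivity
  have hNh : (N : ℝ) * (L / N) = L := by field_simp
  have hps₀ : JetScheme.IsPeriodicSobolev k (N * (L / N)) φ₀ := by
    rw [hNh]; exact hφ₀.isPeriodicSobolev hab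
  have hmain := JetScheme.numericalSolution_bounds h𝒳 (a := a) Δt hh hN hps₀ n
  rw [hNh] at hmain
  obtain ⟨hps, hI, hmean⟩ := hmain
  set φ := JetScheme.numericalSolution k a (L / N) Δt 𝒳 φ₀ n
  have hadm := hps.isAdmissible hab
  have hnT : n * (L / N) ^ (k + 1) ≤ T / c := by
    rw [le_div_iff₀ hc]
    calc n * (L / N) ^ (k + 1) * c = n * (c * (L / N) ^ (k + 1)) := by ring
      _ ≤ n * Δt := by gcongr
      _ ≤ T := hn
  refine ⟨hadm, fun ℓ hℓ => ?_, ?_⟩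
  · refine (JetScheme.normL_top_le (C := B) fun x hx => ?_).trans
      (ENNReal.ofReal_le_ofReal (le_max_left _ _))
    rw [← hb] at hx
    refine (hps.abs_iteratedDeriv_le_of_mean hL hℓ hx).trans ?_
    rw [hB]
    gcongr
    refine hmean.trans ?_
    gcongr
  · refine (JetScheme.normL_two_le (D := D) hab.le hadm.memLp ?_).trans
      (ENNReal.ofReal_le_ofReal (le_max_right _ _))
    exact le_trans (le_of_eq (by rw [hb])) hI
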